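/- Let $X$ and $Y$ be the elements of $PSL(2,\mathbb Z)=SL(2,\mathbb Z)/\{\pm1\}$ represented by the matrices $\begin{pmatrix}-1&1\\-1&0\end{pmatrix}$ and $\begin{pmatrix}0&-1\\1&0\end{pmatrix}$, of order $3$ and $2$ respectively. For a subgroup $H$ of finite index, let $E=PSL(2,\mathbb Z)/H$ be the set of left cosets of $H$, with the left action of $PSL(2,\mathbb Z)$. The skeleton $\mathrm{Sk}$ of $H$ is the bipartite graph with edge set $E$ whose black (resp. white) vertices are the orbits of $\langle X\rangle$ (resp. $\langle Y\rangle$) on $E$, an edge being incident to the two orbits that contain it; its Euler characteristic is $\chi(\mathrm{Sk})=|E/\langle X\rangle|+|E/\langle Y\rangle|-|E|$. (1) Let $H\subset PSL(2,\mathbb Z)$ be a subgroup of finite index, let $n_2$ and $n_3$ be the numbers of monovalent white and black vertices of $\mathrm{Sk}$, i.e. the numbers of cosets in $E$ fixed by $Y$ and by $X$ respectively, and let $n_0=1-\chi(\mathrm{Sk})$. Then $n_0\ge 0$, the group $H$ is isomorphic to the free product of $n_0$ copies of $\mathbb Z$, $n_2$ copies of $\mathbb Z/2$ and $n_3$ copies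 of $\mathbb Z/3$, and $$[PSL(2,\mathbb Z):H]=6n_0+3n_2+4n_3-6 .$$ (2) Every subgroup of $PSL(2,\mathbb Z)$, of finite or infinite index, is isomorphic to a (possibly infinite, possibly empty) free product of copies of $\mathbb Z$, $\mathbb Z/2$ and $\mathbb Z/3$. -/

import Mathlib

open scoped MatrixGroups

/-- The free product of cyclic groups `(∗_I ℤ) ∗ (∗_J ℤ/2) ∗ (∗_K ℤ/3)`. -/
abbrev CyclicFreeProduct (I J K : Type) : Type :=
  Monoid.Coprod (Monoid.CoprodI fun _ : I => Multiplicative ℤ)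
    (Monoid.Coprod (Monoid.CoprodI fun _ : J => Multiplicative (ZMod 2))
      (Monoid.CoprodI fun _ : K => Multiplicative (ZMod 3)))

namespace ModularGroupSkeleton

/-- The matrix `X`, satisfying `X ^ 3 = 1`. -/
def matX : SL(2, ℤ) := ⟨!![-1, 1; -1, 0], by simp [Matrix.det_fin_two]⟩

/-- The matrix `Y`, satisfying `Y ^ 2 = -1`. -/
def matY : SL(2, ℤ) := ⟨!![0, -1; 1, 0], by simp [Matrix.det_fin_two]⟩

/-- The order three generator of `PSL(2, ℤ)`. -/
def X : PSL(2, ℤ) := QuotientGroup.mk matX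

/-- The order two generator of `PSL(2, ℤ)`. -/
def Y : PSL(2, ℤ) := QuotientGroup.mk matY

/-- The edges of the skeleton of `H`, regarded as a bipartite graph: the left cosets of `H`. -/
abbrev Edge (H : Subgroup PSL(2, ℤ)) : Type := PSL(2, ℤ) ⧸ H

/-- The black vertices of the skeleton: the orbits of `⟨X⟩` on the cosets. -/
abbrev BlackVertex (H : Subgroup PSL(2, ℤ)) : Type :=
  MulAction.orbitRel.Quotient (Subgroup.zpowers X) (Edge H)

/-- The white vertices of the skeleton: the orbits of `⟨Y⟩` on the cosets. -/
abbrev WhiteVertex (H : Subgroup PSL(2, ℤ)) : Type :=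
  MulAction.orbitRel.Quotient (Subgroup.zpowers Y) (Edge H)

/-- The number of monovalent white vertices, i.e. of one-element orbits of `Y`
(meaningful if `H` has finite index). -/
noncomputable def monoWhite (H : Subgroup PSL(2, ℤ)) : ℕ :=
  Nat.card {e : Edge H // Y • e = e}

/-- The number of monovalent black vertices, i.e. of one-element orbits of `X`
(meaningful if `H` has finite index). -/
noncomputable def monoBlack (H : Subgroup PSL(2, ℤ)) : ℕ :=
  Nat.card {e : Edge H // X • e = e}

/-- The Euler characteristic (vertices minus edges) of the skeleton of a subgroup of finite
index. -/
noncomputable def eulerChar (H : Subgroup PSL(2, ℤ)) : ℤ :=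
  (Nat.card (BlackVertex H) : ℤ) + (Nat.card (WhiteVertex H) : ℤ) - (Nat.card (Edge H) : ℤ)

end ModularGroupSkeleton

/-! The ping-pong lemma, played on the sign of the product of the entries of the first column, shows
that the modular group is the free product of `⟨X⟩` and `⟨Y⟩` (`exists_hom`). The rest is Bass–Serre
theory by hand, valid for any index. The skeleton of `H` is connected, hence has a spanning tree.
Transport along the tree gives elements `g e`, `u e` carrying the base coset to `e`, adapted to `Y`
and to `X` respectively. The elements `(g e)⁻¹ * u e` for `e` outside the tree, and the conjugates
of `Y` and `X` at their fixed cosets, generate `H` freely.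

Freeness is proved by an explicit inverse: by the universal property, a cocycle on cosets with
values in the abstract free product is determined by its values at `X` and `Y` (`exists_cocycle`),
and its restriction to the stabilizer `H` of the base coset is a homomorphism inverse to the evident
one (`nonempty_mulEquiv`).

The index formula combines Burnside's count of `⟨X⟩`- and `⟨Y⟩`-orbits with the count of tree edges.
-/

/-- An element killed by `n` is the image of the generator of the cyclic group of order `n`. -/
theorem exists_zmod_hom {K : Type*} [Group K] {n : ℕ} {x : K} (hx : x ^ n = 1) :
    ∃ f : Multiplicative (ZMod n) →* K, f (Multiplicative.ofAdd 1) = x := by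
  refine ⟨AddMonoidHom.toMultiplicativeLeft
    (ZMod.lift n ⟨zmultiplesHom (Additive K) (Additive.ofMul x), ?_⟩), ?_⟩
  · simp [← ofMul_pow, hx]
  · have := ZMod.lift_castAddHom n ⟨zmultiplesHom (Additive K) (Additive.ofMul x), by
      simp [← ofMul_pow, hx]⟩ 1
    simp only [AddMonoidHom.toMultiplicativeLeft_apply_apply, toAdd_ofAdd]
    simp at this
    simp [this]

theorem zmod_exists_pow {n : ℕ} (m : Multiplicative (ZMod n)) :
    ∃ k : ℤ, m = (Multiplicative.ofAdd (1 : ZMod n)) ^ k := by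
  obtain ⟨k, hk⟩ := ZMod.intCast_surjective (Multiplicative.toAdd m)
  exact ⟨k, by rw [← ofAdd_zsmul, zsmul_one, hk, ofAdd_toAdd]⟩

theorem zmod_hom_ext {K : Type*} [Group K] {n : ℕ} {f g : Multiplicative (ZMod n) →* K}
    (h : f (Multiplicative.ofAdd 1) = g (Multiplicative.ofAdd 1)) : f = g := by
  refine MonoidHom.ext fun m => ?_
  obtain ⟨k, rfl⟩ := zmod_exists_pow m
  rw [map_zpow, map_zpow, h]

/-! ### The modular group as a free product, by ping-pong. -/

namespace ModularGroupSkeleton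

theorem coe_matX : (matX : Matrix (Fin 2) (Fin 2) ℤ) = !![-1, 1; -1, 0] := rfl

theorem coe_matY : (matY : Matrix (Fin 2) (Fin 2) ℤ) = !![0, -1; 1, 0] := rfl

theorem X_pow_three : X ^ 3 = 1 := by
  have : matX ^ 3 = 1 := by
    refine Subtype.ext ?_
    rw [Matrix.SpecialLinearGroup.coe_pow, coe_matX]
    decide
  rw [X, ← QuotientGroup.mk_pow, this, QuotientGroup.mk_one]

theorem Y_sq : Y ^ 2 = 1 := by
  rw [Y, ← QuotientGroup.mk_pow, QuotientGroup.eq_one_iff,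
    Matrix.SpecialLinearGroup.mem_center_iff]
  refine ⟨-1, by simp, ?_⟩
  rw [Matrix.SpecialLinearGroup.coe_pow, coe_matY]
  decide

theorem closure_XY : Subgroup.closure {X, Y} = ⊤ := by
  have hY : matY = ModularGroup.S := by
    ext i j; fin_cases i <;> fin_cases j <;> simp [matY, ModularGroup.S]
  have hT : matX * matY = ModularGroup.T := by
    refine Subtype.ext ?_
    rw [Matrix.SpecialLinearGroup.coe_mul, coe_matX, coe_matY, ModularGroup.coe_T]
    decide
  rw [eq_top_iff]
  rintro ⟨g⟩ -
  have hg : g ∈ Subgroup.closure {ModularGroup.S, ModularGroup.T} := by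
    rw [SpecialLinearGroup.SL2Z_generators]; trivial
  change g ∈ (Subgroup.closure {X, Y}).comap (QuotientGroup.mk' _)
  refine (Subgroup.closure_le _).2 ?_ hg
  have h1 : X ∈ Subgroup.closure {X, Y} := Subgroup.subset_closure (by simp)
  have h2 : Y ∈ Subgroup.closure {X, Y} := Subgroup.subset_closure (by simp)
  rintro _ (rfl | rfl)
  · rw [← hY]; exact h2
  · rw [← hT]; exact mul_mem h1 h2

/-- The product of the entries of the first column, well defined up to sign of the matrix. -/
def colProd (g : PSL(2, ℤ)) : ℤ :=
  Quotient.liftOn' g (fun A : SL(2, ℤ) => A 0 0 * A 1 0) (by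
    intro A B h
    rw [QuotientGroup.leftRel_apply, Matrix.SpecialLinearGroup.mem_center_iff] at h
    obtain ⟨r, hr, h⟩ := h
    have hB : B.1 = A.1 * Matrix.scalar (Fin 2) r := by
      rw [h, ← Matrix.SpecialLinearGroup.coe_mul, mul_inv_cancel_left]
    change A.1 0 0 * A.1 1 0 = B.1 0 0 * B.1 1 0
    simp only [Fintype.card_fin] at hr
    have hC (i : Fin 2) : B.1 i 0 = A.1 i 0 * r := by
      rw [hB, Matrix.mul_apply, Fin.sum_univ_two]
      simp only [Matrix.scalar_apply, Matrix.diagonal_apply]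
      simp
    rw [hC, hC]
    linear_combination (-(A.1 0 0 * A.1 1 0)) * hr)

theorem colProd_mk (A : SL(2, ℤ)) : colProd (QuotientGroup.mk A) = A.1 0 0 * A.1 1 0 := rfl

theorem colProd_Y_mul (g : PSL(2, ℤ)) : colProd (Y * g) = -colProd g := by
  obtain ⟨A, rfl⟩ := QuotientGroup.mk_surjective g
  rw [Y, ← QuotientGroup.mk_mul, colProd_mk, colProd_mk,
    Matrix.SpecialLinearGroup.coe_mul, coe_matY, Matrix.mul_apply, Matrix.mul_apply]
  simp [Fin.sum_univ_two]
  ring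

/-- `X` sends a first column `(a, c)` to `(c - a, -a)`, with product `a² - ac`; `X ^ 2` gives `(-c,
a - c)`, with product `c² - ac`. -/
theorem colProd_X_mul_pos {g : PSL(2, ℤ)} (h : colProd g < 0) : 0 < colProd (X * g) := by
  obtain ⟨A, rfl⟩ := QuotientGroup.mk_surjective g
  rw [X, ← QuotientGroup.mk_mul, colProd_mk,
    Matrix.SpecialLinearGroup.coe_mul, coe_matX, Matrix.mul_apply, Matrix.mul_apply]
  rw [colProd_mk] at h
  simp [Fin.sum_univ_two]
  nlinarith [sq_nonneg (A.1 0 0)]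

theorem colProd_X_sq_mul_pos {g : PSL(2, ℤ)} (h : colProd g < 0) :
    0 < colProd (X ^ 2 * g) := by
  obtain ⟨A, rfl⟩ := QuotientGroup.mk_surjective g
  rw [X, ← QuotientGroup.mk_pow, ← QuotientGroup.mk_mul, colProd_mk,
    Matrix.SpecialLinearGroup.coe_mul, Matrix.SpecialLinearGroup.coe_pow, coe_matX,
    Matrix.mul_apply, Matrix.mul_apply]
  rw [colProd_mk] at h
  simp [Fin.sum_univ_two, pow_succ]
  nlinarith [sq_nonneg (A.1 1 0)]

theorem exists_colProd_neg : ∃ g, colProd g < 0 :=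
  ⟨QuotientGroup.mk ⟨!![1, 0; -1, 1], by simp [Matrix.det_fin_two]⟩, by
    change ((1 : ℤ) * -1 < 0); decide⟩

theorem exists_colProd_pos : ∃ g, 0 < colProd g :=
  exists_colProd_neg.imp' (Y * ·) fun g h => by rw [colProd_Y_mul]; omega

theorem orderOf_X : orderOf X = 3 := by
  have : Fact (Nat.Prime 3) := ⟨by norm_num⟩
  refine orderOf_eq_prime X_pow_three fun h => ?_
  obtain ⟨g, hg⟩ := exists_colProd_neg
  have := colProd_X_mul_pos hg
  rw [h, one_mul] at this
  omega

theorem orderOf_Y : orderOf Y = 2 := by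
  refine orderOf_eq_prime Y_sq fun h => ?_
  obtain ⟨g, hg⟩ := exists_colProd_neg
  have := colProd_Y_mul g
  rw [h, one_mul] at this
  omega

/-- The family of cyclic groups of order `2` and `3`. -/
abbrev Factor (b : Bool) : Type := Multiplicative (ZMod (cond b 3 2))

theorem exists_factor_hom {K : Type*} [Group K] {x y : K} (hx : x ^ 3 = 1) (hy : y ^ 2 = 1) :
    ∃ f : ∀ b, Factor b →* K, f true (Multiplicative.ofAdd (1 : ZMod 3)) = x ∧
      f false (Multiplicative.ofAdd (1 : ZMod 2)) = y := by
  obtain ⟨fx, hfx⟩ := exists_zmod_hom hx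
  obtain ⟨fy, hfy⟩ := exists_zmod_hom hy
  exact ⟨fun b => match b with | true => fx | false => fy, hfx, hfy⟩

open Monoid Pointwise in
/-- The universal property of the modular group as the free product of `⟨X⟩` and `⟨Y⟩`. -/
theorem exists_hom {K : Type*} [Group K] {x y : K} (hx : x ^ 3 = 1) (hy : y ^ 2 = 1) :
    ∃ f : PSL(2, ℤ) →* K, f X = x ∧ f Y = y := by
  obtain ⟨f, hfX, hfY⟩ := exists_factor_hom X_pow_three Y_sq
  obtain ⟨k, hkX, hkY⟩ := exists_factor_hom hx hy
  have hinj : Function.Injective (CoprodI.lift f) := by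
    -- With only two factors, ping-pong needs one of them to have at least three elements: here
    -- `⟨X⟩`.
    refine CoprodI.lift_injective_of_ping_pong f (.inr ⟨true, ?_⟩)
      (fun b => {g | cond b (0 < colProd g) (colProd g < 0)}) ?_ ?_ ?_
    · simp [Factor]
    · rintro (_ | _)
      · exact exists_colProd_neg
      · exact exists_colProd_pos
    · rintro (_ | _) (_ | _) h
      · exact absurd rfl h
      · exact Set.disjoint_left.2 fun g h1 h2 => lt_asymm (α := ℤ) h1 h2
      · exact Set.disjoint_left.2 fun g h1 h2 => lt_asymm (α := ℤ) h1 h2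
      · exact absurd rfl h
    · rintro (_ | _) (_ | _) h
      · exact absurd rfl h
      · intro z hz
        have : z = Multiplicative.ofAdd (1 : ZMod 2) := by
          have : ∀ z : Multiplicative (ZMod 2), z ≠ 1 → z = Multiplicative.ofAdd 1 := by decide
          exact this z hz
        subst this
        rintro _ ⟨g, hg, rfl⟩
        change colProd (f false _ * g) < 0
        rw [hfY, colProd_Y_mul]
        exact neg_neg_of_pos hg
      · intro z hz
        have : z = Multiplicative.ofAdd (1 : ZMod 3) ∨
            z = Multiplicative.ofAdd (1 : ZMod 3) ^ 2 := by
          have : ∀ z : Multiplicative (ZMod 3), z ≠ 1 →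
              z = Multiplicative.ofAdd 1 ∨ z = Multiplicative.ofAdd 1 ^ 2 := by decide
          exact this z hz
        rintro _ ⟨g, hg, rfl⟩
        change 0 < colProd (f true _ * g)
        rcases this with rfl | rfl
        · rw [hfX]; exact colProd_X_mul_pos hg
        · rw [map_pow, hfX]; exact colProd_X_sq_mul_pos hg
      · exact absurd rfl h
  have hX : CoprodI.lift f (CoprodI.of (i := true) (Multiplicative.ofAdd (1 : ZMod 3))) = X := by
    rw [CoprodI.lift_of, hfX]
  have hY : CoprodI.lift f (CoprodI.of (i := false) (Multiplicative.ofAdd (1 : ZMod 2))) = Y := by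
    rw [CoprodI.lift_of, hfY]
  have hsurj : Function.Surjective (CoprodI.lift f) := by
    rw [← MonoidHom.range_eq_top, eq_top_iff, ← closure_XY, Subgroup.closure_le]
    rintro _ (rfl | rfl)
    exacts [⟨_, hX⟩, ⟨_, hY⟩]
  let e := MulEquiv.ofBijective (CoprodI.lift f) ⟨hinj, hsurj⟩
  refine ⟨(CoprodI.lift k).comp e.symm.toMonoidHom, ?_, ?_⟩
  · change CoprodI.lift k (e.symm X) = x
    rw [← hX, show e.symm (CoprodI.lift f _) = _ from e.symm_apply_apply _, CoprodI.lift_of, hkX]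
  · change CoprodI.lift k (e.symm Y) = y
    rw [← hY, show e.symm (CoprodI.lift f _) = _ from e.symm_apply_apply _, CoprodI.lift_of, hkY]

end ModularGroupSkeleton

/-! ### Generators and universal property of the free product of cyclic groups. -/

namespace CyclicFreeProduct

open Monoid

variable {I J K : Type}

instance : Group (CyclicFreeProduct I J K) :=
  letI : Group (Coprod (CoprodI fun _ : J => Multiplicative (ZMod 2))
    (CoprodI fun _ : K => Multiplicative (ZMod 3))) := Coprod.instGroup
  Coprod.instGroup

/-- The generator of infinite order with index `i`. -/
def genZ (i : I) : CyclicFreeProduct I J K :=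
  Coprod.inl (CoprodI.of (i := i) (Multiplicative.ofAdd (1 : ℤ)))

/-- The generator of order two with index `j`. -/
def genTwo (j : J) : CyclicFreeProduct I J K :=
  Coprod.inr (Coprod.inl (CoprodI.of (i := j) (Multiplicative.ofAdd (1 : ZMod 2))))

/-- The generator of order three with index `k`. -/
def genThree (k : K) : CyclicFreeProduct I J K :=
  Coprod.inr (Coprod.inr (CoprodI.of (i := k) (Multiplicative.ofAdd (1 : ZMod 3))))

theorem genTwo_sq (j : J) : (genTwo j : CyclicFreeProduct I J K) ^ 2 = 1 := by
  rw [genTwo, ← map_pow, ← map_pow, ← map_pow,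
    show Multiplicative.ofAdd (1 : ZMod 2) ^ 2 = 1 by decide, map_one, map_one, map_one]

theorem genThree_pow (k : K) : (genThree k : CyclicFreeProduct I J K) ^ 3 = 1 := by
  rw [genThree, ← map_pow, ← map_pow, ← map_pow,
    show Multiplicative.ofAdd (1 : ZMod 3) ^ 3 = 1 by decide, map_one, map_one, map_one]

theorem exists_lift {L : Type*} [Group L] (a : I → L) (b : J → L) (c : K → L)
    (hb : ∀ j, b j ^ 2 = 1) (hc : ∀ k, c k ^ 3 = 1) :
    ∃ f : CyclicFreeProduct I J K →* L, (∀ i, f (genZ i) = a i) ∧ (∀ j, f (genTwo j) = b j) ∧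
      ∀ k, f (genThree k) = c k := by
  choose fb hfb using fun j => exists_zmod_hom (hb j)
  choose fc hfc using fun k => exists_zmod_hom (hc k)
  refine ⟨Coprod.lift (CoprodI.lift fun i => zpowersHom L (a i))
    (Coprod.lift (CoprodI.lift fb) (CoprodI.lift fc)), fun i => ?_, fun j => ?_, fun k => ?_⟩
  · simp [genZ]
  · simp [genTwo, hfb]
  · simp [genThree, hfc]

theorem hom_ext {L : Type*} [Group L] {f g : CyclicFreeProduct I J K →* L}
    (hZ : ∀ i, f (genZ i) = g (genZ i)) (hTwo : ∀ j, f (genTwo j) = g (genTwo j))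
    (hThree : ∀ k, f (genThree k) = g (genThree k)) : f = g := by
  refine Coprod.hom_ext (CoprodI.ext_hom _ _ fun i => ?_)
    (Coprod.hom_ext (CoprodI.ext_hom _ _ fun j => ?_) (CoprodI.ext_hom _ _ fun k => ?_))
  · exact MonoidHom.ext_mint (hZ i)
  · exact zmod_hom_ext (hTwo j)
  · exact zmod_hom_ext (hThree k)

end CyclicFreeProduct

/-! ### Actions of cyclic groups of prime order. -/

section PrimeOrder

variable {G E : Type*} [Group G] [MulAction G E] {z : G}

/-- A nontrivial element of a group of prime order generates it, so each orbit is either free or a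
single point. -/
theorem smul_eq_self_of_zpowers_fixes (hz : (orderOf z).Prime) {k : G}
    (hk : k ∈ Subgroup.zpowers z) (hk1 : k ≠ 1) {e : E} (he : k • e = e) : z • e = e := by
  have : Fact (orderOf z).Prime := ⟨hz⟩
  have hcard : Nat.card (Subgroup.zpowers z) = orderOf z := Nat.card_zpowers z
  have hmem : (⟨z, Subgroup.mem_zpowers z⟩ : Subgroup.zpowers z) ∈
      Subgroup.zpowers (⟨k, hk⟩ : Subgroup.zpowers z) :=
    mem_zpowers_of_prime_card hcard (by simpa [Subtype.ext_iff] using hk1)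
  obtain ⟨n, hn⟩ := hmem
  have hn' : k ^ n = z := congrArg Subtype.val hn
  rw [← hn']
  exact zpow_mem (K := MulAction.stabilizer G e) he n

/-- A transversal cocycle for the action of a cyclic group of prime order. -/
theorem exists_orbit_section (hz : (orderOf z).Prime) (base : E → E)
    (hbase : ∀ e, ∃ k ∈ Subgroup.zpowers z, k • base e = e)
    (hsmul : ∀ e, base (z • e) = base e) (hbb : ∀ e, base (base e) = base e) :
    ∃ ζ : E → G, (∀ e, ζ e • base e = e) ∧ (∀ e, z • e ≠ e → ζ (z • e) = z * ζ e) ∧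
      ∀ e, ζ (base e) = 1 := by
  classical
  choose κ hκ hκe using hbase
  -- At a fixed point `base e = e`, so the value must be `1`; on a free orbit `κ e` is the only
  -- choice within `⟨z⟩`.
  refine ⟨fun e => if z • e = e then 1 else κ e, fun e => ?_, fun e he => ?_, fun e => ?_⟩
  · dsimp only
    split_ifs with h
    · rw [one_smul]
      have : κ e • base e = κ e • e := by
        rw [hκe]
        refine Eq.symm ?_
        obtain ⟨n, hn⟩ := hκ e
        rw [← hn]
        exact zpow_mem (K := MulAction.stabilizer G e) h n
      exact smul_left_cancel _ this
    · exact hκe e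
  · have he' : z • z • e ≠ z • e := fun h => he (smul_left_cancel _ h)
    simp only [he, he', if_false]
    by_contra hne
    have hmem : (z * κ e)⁻¹ * κ (z • e) ∈ Subgroup.zpowers z :=
      mul_mem (inv_mem (mul_mem (Subgroup.mem_zpowers z) (hκ e))) (hκ _)
    have hfix : ((z * κ e)⁻¹ * κ (z • e)) • base e = base e := by
      have h1 := hκe (z • e)
      rw [hsmul] at h1
      rw [mul_smul, h1, inv_smul_eq_iff, mul_smul, hκe]
    have h2 := smul_eq_self_of_zpowers_fixes hz hmem
      (fun h => hne (inv_mul_eq_one.1 h).symm) hfix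
    apply he
    have h3 : z * κ e = κ e * z := by
      obtain ⟨n, hn⟩ := hκ e
      rw [← hn]
      exact ((Commute.refl z).zpow_right n)
    conv_lhs => rw [← hκe e, smul_smul, h3, mul_smul, h2]
    exact hκe e
  · dsimp only
    split_ifs with h
    · rfl
    · by_contra hne
      have := hκe (base e)
      rw [hbb] at this
      exact h (smul_eq_self_of_zpowers_fixes hz (hκ _) hne this)

/-- Burnside's count for a cyclic group of prime order. -/
theorem prime_mul_card_orbits [Finite E] (hz : (orderOf z).Prime) :
    orderOf z * Nat.card (MulAction.orbitRel.Quotient (Subgroup.zpowers z) E) =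
      Nat.card E + (orderOf z - 1) * Nat.card {e : E // z • e = e} := by
  classical
  have hcard : Nat.card (Subgroup.zpowers z) = orderOf z := Nat.card_zpowers z
  have : Finite (Subgroup.zpowers z) := Nat.finite_of_card_ne_zero (by rw [hcard]; exact hz.ne_zero)
  have := Fintype.ofFinite (Subgroup.zpowers z)
  have := Fintype.ofFinite E
  have := Fintype.ofFinite (MulAction.orbitRel.Quotient (Subgroup.zpowers z) E)
  have hB := MulAction.sum_card_fixedBy_eq_card_orbits_mul_card_group (Subgroup.zpowers z) E
  rw [← Nat.card_eq_fintype_card (α := Subgroup.zpowers z), hcard,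
    ← Nat.card_eq_fintype_card (α := MulAction.orbitRel.Quotient _ E)] at hB
  rw [mul_comm, ← hB, ← Finset.add_sum_erase _ _ (Finset.mem_univ (1 : Subgroup.zpowers z))]
  congr 1
  · rw [Nat.card_eq_fintype_card]
    exact Fintype.card_congr (Equiv.subtypeUnivEquiv fun e => one_smul _ e)
  -- Every nontrivial power of `z` has the same fixed points as `z`.
  · rw [Finset.sum_congr rfl (g := fun _ => Nat.card {e : E // z • e = e}), Finset.sum_const,
      Finset.card_erase_of_mem (Finset.mem_univ _), Finset.card_univ,
      ← Nat.card_eq_fintype_card, hcard, smul_eq_mul]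
    intro k hk
    rw [← Nat.card_eq_fintype_card]
    refine Nat.card_congr (Equiv.subtypeEquivRight fun e => ⟨fun h => ?_, fun h => ?_⟩)
    · refine smul_eq_self_of_zpowers_fixes hz k.2 (fun h => ?_) h
      exact Finset.ne_of_mem_erase hk (Subtype.ext h)
    · obtain ⟨n, hn⟩ := k.2
      change k.1 • e = e
      rw [← hn]
      exact zpow_mem (K := MulAction.stabilizer G e) h n

/-- Finite order makes every power of `z` a nonnegative one, so stability under `z` alone suffices.
-/
theorem orbitRel_zpowers_induction (hz : IsOfFinOrder z) {Q : E → Prop}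
    (hQ : ∀ e, Q e → Q (z • e)) {e e' : E}
    (h : (Quotient.mk'' e : MulAction.orbitRel.Quotient (Subgroup.zpowers z) E) =
      Quotient.mk'' e') (he : Q e) : Q e' := by
  obtain ⟨⟨k, hk⟩, hke⟩ := MulAction.orbitRel_apply.1 (Quotient.exact' h.symm)
  rw [← hz.mem_powers_iff_mem_zpowers] at hk
  obtain ⟨n, rfl⟩ := hk
  change z ^ n • e = e' at hke
  subst hke
  clear h hk
  induction n with
  | zero => simpa using he
  | succ n ih => rw [pow_succ', mul_smul]; exact hQ _ ih

end PrimeOrder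

/-! ### Spanning trees of bipartite graphs. -/

/-- A rooted spanning tree of the bipartite graph with edge set `E` and incidence maps `b`, `w`,
given by the parent edge of each vertex; the root is `w e₀`. -/
structure SpanningTree {E B W : Type*} (b : E → B) (w : E → W) (e₀ : E) where
  /-- The parent edge of a black vertex. -/
  parB : B → E
  /-- The parent edge of a white vertex. -/
  parW : W → E
  /-- The distance from the root to a black vertex. -/
  rankB : B → ℕ
  /-- The distance from the root to a white vertex. -/
  rankW : W → ℕ
  b_parB : ∀ v, b (parB v) = v
  w_parW : ∀ v, w (parW v) = v
  -- The root has no parent; this value only normalises transport to be `1` at `e₀`.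
  parW_root : parW (w e₀) = e₀
  rankW_lt : ∀ v, rankW (w (parB v)) < rankB v
  rankB_lt : ∀ v, v ≠ w e₀ → rankB (b (parW v)) < rankW v

/-- Vertices reachable from the root along a path of given length. -/
inductive ReachableIn {E B W : Type*} (b : E → B) (w : E → W) (e₀ : E) : ℕ → B ⊕ W → Prop
  | root : ReachableIn b w e₀ 0 (.inr (w e₀))
  | black (n : ℕ) (e : E) : ReachableIn b w e₀ n (.inr (w e)) →
      ReachableIn b w e₀ (n + 1) (.inl (b e))
  | white (n : ℕ) (e : E) : ReachableIn b w e₀ n (.inl (b e)) →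
      ReachableIn b w e₀ (n + 1) (.inr (w e))

namespace SpanningTree

variable {E B W : Type*} {b : E → B} {w : E → W} {e₀ : E}

/-- The rank is the length of a shortest path from the root, and the last edge of such a path is the
parent edge. -/
theorem nonempty_of_connected (hb : Function.Surjective b) (hw : Function.Surjective w)
    (hconn : ∀ S : E → Prop, S e₀ → (∀ e e', b e = b e' → S e → S e') →
      (∀ e e', w e = w e' → S e → S e') → ∀ e, S e) : Nonempty (SpanningTree b w e₀) := by
  classical
  have hreach : ∀ e, (∃ n, ReachableIn b w e₀ n (.inl (b e))) ∧
      ∃ n, ReachableIn b w e₀ n (.inr (w e)) := by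
    refine hconn _ ⟨⟨_, .black _ _ .root⟩, _, .root⟩ ?_ ?_
    · rintro e e' h ⟨⟨n, hn⟩, -⟩
      rw [h] at hn
      exact ⟨⟨n, hn⟩, _, .white _ _ hn⟩
    · rintro e e' h ⟨-, n, hn⟩
      rw [h] at hn
      exact ⟨⟨_, .black _ _ hn⟩, n, hn⟩
  have hB : ∀ v, ∃ n, ReachableIn b w e₀ n (.inl v) := fun v => by
    obtain ⟨e, rfl⟩ := hb v; exact (hreach e).1
  have hW : ∀ v, ∃ n, ReachableIn b w e₀ n (.inr v) := fun v => by
    obtain ⟨e, rfl⟩ := hw v; exact (hreach e).2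
  have hpB : ∀ v, ∃ e, b e = v ∧ Nat.find (hW (w e)) < Nat.find (hB v) := fun v => by
    have h := Nat.find_spec (hB v)
    generalize hn : Nat.find (hB v) = n at h
    cases h with
    | black n e h => exact ⟨e, rfl, Nat.lt_succ_of_le (Nat.find_min' _ h)⟩
  have hpW : ∀ v, ∃ e, w e = v ∧ (v = w e₀ → e = e₀) ∧
      (v ≠ w e₀ → Nat.find (hB (b e)) < Nat.find (hW v)) := fun v => by
    by_cases hv : v = w e₀
    · exact ⟨e₀, hv.symm, fun _ => rfl, fun h => absurd hv h⟩
    have h := Nat.find_spec (hW v)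
    generalize hn : Nat.find (hW v) = n at h
    cases h with
    | root => exact absurd rfl hv
    | white n e h =>
      exact ⟨e, rfl, fun h => absurd h hv, fun _ => Nat.lt_succ_of_le (Nat.find_min' _ h)⟩
  choose pB hpB1 hpB2 using hpB
  choose pW hpW1 hpW2 hpW3 using hpW
  exact ⟨⟨pB, pW, fun v => Nat.find (hB v), fun v => Nat.find (hW v), hpB1, hpW1, hpW2 _ rfl, hpB2, hpW3⟩⟩

variable (t : SpanningTree b w e₀)

/-- The edges of the tree. -/
def edges : Set E := {e | (∃ v, t.parB v = e) ∨ ∃ v, v ≠ w e₀ ∧ t.parW v = e}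

/-- `P` spreads around white vertices and `Q` around black ones; a tree edge lets one pass to the
other, so strong induction on rank reaches every edge. -/
theorem induction {P Q : E → Prop} (h₀ : P e₀) (hP : ∀ e e', w e = w e' → P e → P e')
    (hQ : ∀ e e', b e = b e' → Q e → Q e') (hPQ : ∀ e ∈ t.edges, (P e ↔ Q e)) (e : E) :
    P e ∧ Q e := by
  have key : ∀ n, (∀ e, t.rankW (w e) = n → P e) ∧ (∀ e, t.rankB (b e) = n → Q e) := by
    intro n
    induction n using Nat.strong_induction_on with
    | _ n ih =>
      constructor
      · intro e he
        by_cases hv : w e = w e₀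
        · exact hP _ _ hv.symm h₀
        · refine hP (t.parW (w e)) e (t.w_parW _) ((hPQ _ (.inr ⟨_, hv, rfl⟩)).2 ?_)
          exact (ih _ (he ▸ t.rankB_lt _ hv)).2 _ rfl
      · intro e he
        refine hQ (t.parB (b e)) e (t.b_parB _) ((hPQ _ (.inl ⟨_, rfl⟩)).1 ?_)
        exact (ih _ (he ▸ t.rankW_lt _)).1 _ rfl
  exact ⟨(key _).1 e rfl, (key _).2 e rfl⟩

/-- Each vertex other than the root owns its parent edge. No edge is owned by both its endpoints,
since each rank would then be smaller than the other. -/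
theorem card_edges [Finite E] : Nat.card t.edges + 1 = Nat.card B + Nat.card W := by
  classical
  have hB : Finite B := Finite.of_injective t.parB (Function.LeftInverse.injective t.b_parB)
  have hW : Finite W := Finite.of_injective t.parW (Function.LeftInverse.injective t.w_parW)
  let f : B ⊕ {v : W // v ≠ w e₀} → t.edges :=
    Sum.elim (fun v => ⟨t.parB v, .inl ⟨v, rfl⟩⟩) fun v => ⟨t.parW v, .inr ⟨v, v.2, rfl⟩⟩
  have hne : ∀ (v : B) (u : {u : W // u ≠ w e₀}), t.parB v ≠ t.parW u := fun v u h => by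
    have h1 := t.rankW_lt v
    have h2 := t.rankB_lt u u.2
    rw [h, t.w_parW] at h1
    rw [← h, t.b_parB] at h2
    omega
  have hf : Function.Bijective f := by
    constructor
    · rintro (v | v) (u | u) h <;> have h := congrArg Subtype.val h
      · exact congrArg _ ((Function.LeftInverse.injective t.b_parB) h)
      · exact absurd h (hne _ _)
      · exact absurd h.symm (hne _ _)
      · exact congrArg _ (Subtype.ext ((Function.LeftInverse.injective t.w_parW) h))
    · rintro ⟨_, ⟨v, rfl⟩ | ⟨v, hv, rfl⟩⟩
      · exact ⟨.inl v, rfl⟩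
      · exact ⟨.inr ⟨v, hv⟩, rfl⟩
  rw [← Nat.card_congr (Equiv.ofBijective f hf), Nat.card_sum, add_assoc,
    ← Nat.card_congr (Equiv.optionSubtypeNe (w e₀)), Finite.card_option]

/-- Group elements can be multiplied along the branches of the tree. -/
theorem exists_branch_prod {G : Type*} [Monoid G] (fB : B → G) (fW : W → G) :
    ∃ (PB : B → G) (PW : W → G), PW (w e₀) = 1 ∧
      (∀ v, PB v = fB v * PW (w (t.parB v))) ∧
      ∀ v, v ≠ w e₀ → PW v = fW v * PB (b (t.parW v)) := by
  classical
  let r : B ⊕ W → ℕ := Sum.elim t.rankB t.rankW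
  let F : ∀ v : B ⊕ W, (∀ u, r u < r v → G) → G := fun v =>
    match v with
    | .inl v => fun P => fB v * P (.inr (w (t.parB v))) (t.rankW_lt v)
    | .inr v => fun P =>
      if h : v = w e₀ then 1 else fW v * P (.inl (b (t.parW v))) (t.rankB_lt v h)
  let P := (measure r).wf.fix F
  have hP : ∀ v, P v = F v fun u _ => P u := fun v => (measure r).wf.fix_eq F v
  refine ⟨fun v => P (.inl v), fun v => P (.inr v), ?_, fun v => ?_, fun v hv => ?_⟩
  · exact (hP _).trans (dif_pos rfl)
  · exact hP _
  · exact (hP _).trans (dif_neg hv)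

end SpanningTree

/-! ### Cocycles on cosets and the structure of subgroups. -/

namespace ModularGroupSkeleton

/-- The permutation of `E × F` covering the action of `z` on `E` by left translations of `F`. -/
def twistedPerm {G E F : Type*} [Group G] [MulAction G E] [Group F] (z : G) (a : E → F) :
    Equiv.Perm (E × F) where
  toFun p := (z • p.1, a p.1 * p.2)
  invFun p := (z⁻¹ • p.1, (a (z⁻¹ • p.1))⁻¹ * p.2)
  left_inv p := by simp
  right_inv p := by simp

theorem twistedPerm_apply {G E F : Type*} [Group G] [MulAction G E] [Group F] (z : G) (a : E → F)
    (e : E) (f : F) : twistedPerm z a (e, f) = (z • e, a e * f) := rfl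

/-- A cocycle on the modular group is freely determined by its values on the generators. -/
theorem exists_cocycle {E F : Type*} [MulAction PSL(2, ℤ) E] [Group F] {a c : E → F}
    (ha : ∀ e, a (X ^ 2 • e) * a (X • e) * a e = 1) (hc : ∀ e, c (Y • e) * c e = 1) :
    ∃ σ : PSL(2, ℤ) → E → F, (∀ g h e, σ (g * h) e = σ g (h • e) * σ h e) ∧
      σ X = a ∧ σ Y = c := by
  have hx : twistedPerm X a ^ 3 = 1 := by
    ext1 ⟨e, f⟩
    have := ha e
    rw [pow_two, mul_smul] at this
    simp only [pow_succ, pow_zero, one_mul, Equiv.Perm.mul_apply, twistedPerm_apply,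
      Equiv.Perm.one_apply]
    rw [← mul_assoc, ← mul_assoc, this, one_mul, smul_smul, smul_smul, 
      ← pow_two, ← pow_succ, X_pow_three, one_smul]
  have hy : twistedPerm Y c ^ 2 = 1 := by
    ext1 ⟨e, f⟩
    simp only [pow_succ, pow_zero, one_mul, Equiv.Perm.mul_apply, twistedPerm_apply,
      Equiv.Perm.one_apply]
    rw [← mul_assoc, hc, one_mul, smul_smul, ← pow_two, Y_sq, one_smul]
  obtain ⟨Φ, hΦX, hΦY⟩ := exists_hom hx hy
  -- The lifted action commutes with right translations of `F`, so it is determined by its values at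
  -- `1`; these form the cocycle.
  have hΦ : ∀ g : PSL(2, ℤ), ∀ e f, Φ g (e, f) = (g • e, (Φ g (e, 1)).2 * f) := by
    intro g
    have hg : g ∈ Subgroup.closure {X, Y} := by rw [closure_XY]; trivial
    induction hg using Subgroup.closure_induction with
    | mem g hg =>
      intro e f
      rcases hg with rfl | rfl
      · simp only [hΦX, twistedPerm_apply, mul_one]
      · simp only [hΦY, twistedPerm_apply, mul_one]
    | one => simp
    | mul g h _ _ hg hh =>
      intro e f
      rw [map_mul, Equiv.Perm.mul_apply, Equiv.Perm.mul_apply, hh e f, hh e 1, hg _ (_ * f),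
        hg _ (_ * 1), mul_smul]
      simp only [mul_one, mul_assoc]
    | inv g _ hg =>
      intro e f
      have key : ∀ f, Φ g⁻¹ (e, f) = (g⁻¹ • e, ((Φ g (g⁻¹ • e, 1)).2)⁻¹ * f) := by
        intro f
        rw [map_inv, Equiv.Perm.inv_eq_iff_eq, hg]
        simp
      rw [key f, key 1, mul_one]
  refine ⟨fun g e => (Φ g (e, 1)).2, fun g h e => ?_, ?_, ?_⟩
  · dsimp only
    rw [map_mul, Equiv.Perm.mul_apply, hΦ h, hΦ g]
  · ext e; simp [hΦX, twistedPerm_apply]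
  · ext e; simp [hΦY, twistedPerm_apply]

variable {H : Subgroup PSL(2, ℤ)}

/-- The black endpoint of an edge. -/
def black (e : Edge H) : BlackVertex H := Quotient.mk'' e

/-- The white endpoint of an edge. -/
def white (e : Edge H) : WhiteVertex H := Quotient.mk'' e

/-- The coset `H` itself. -/
def baseEdge (H : Subgroup PSL(2, ℤ)) : Edge H := QuotientGroup.mk 1

theorem smul_baseEdge_iff {g : PSL(2, ℤ)} : g • baseEdge H = baseEdge H ↔ g ∈ H := by
  change (QuotientGroup.mk (g * 1) : Edge H) = QuotientGroup.mk 1 ↔ _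
  rw [mul_one, eq_comm, QuotientGroup.eq, inv_one, one_mul]

theorem mk_smul {E : Type*} [MulAction PSL(2, ℤ) E] (z : PSL(2, ℤ)) (e : E) :
    (Quotient.mk'' (z • e) : MulAction.orbitRel.Quotient (Subgroup.zpowers z) E) =
      Quotient.mk'' e :=
  Quotient.sound' ⟨⟨z, Subgroup.mem_zpowers z⟩, rfl⟩

theorem black_smul (e : Edge H) : black (X • e) = black e := mk_smul X e

theorem white_smul (e : Edge H) : white (Y • e) = white e := mk_smul Y e

theorem isOfFinOrder_X : IsOfFinOrder X :=
  orderOf_pos_iff.1 (by rw [orderOf_X]; norm_num)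

theorem isOfFinOrder_Y : IsOfFinOrder Y :=
  orderOf_pos_iff.1 (by rw [orderOf_Y]; norm_num)

theorem black_induction {Q : Edge H → Prop} (hQ : ∀ e, Q e → Q (X • e)) (e e' : Edge H)
    (h : black e = black e') (he : Q e) : Q e' :=
  orbitRel_zpowers_induction isOfFinOrder_X hQ h he

theorem white_induction {Q : Edge H → Prop} (hQ : ∀ e, Q e → Q (Y • e)) (e e' : Edge H)
    (h : white e = white e') (he : Q e) : Q e' :=
  orbitRel_zpowers_induction isOfFinOrder_Y hQ h he

theorem conj_pow_eq_one {G : Type*} [Group G] {z a : G} {n : ℕ} (hz : z ^ n = 1) :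
    (a⁻¹ * (z * a)) ^ n = 1 := by
  have := conj_pow (a := a⁻¹) (b := z) (i := n)
  rw [inv_inv, hz, mul_assoc] at this
  rw [this]; group

/-- Connectedness of the skeleton is transitivity on cosets of the group generated by `X` and `Y`.
-/
theorem nonempty_spanningTree (H : Subgroup PSL(2, ℤ)) :
    Nonempty (SpanningTree (black (H := H)) white (baseEdge H)) := by
  refine SpanningTree.nonempty_of_connected Quotient.mk''_surjective Quotient.mk''_surjective ?_
  intro S h₀ hb hw
  have key : ∀ g : PSL(2, ℤ), ∀ e, S e ↔ S (g • e) := by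
    intro g
    have hg : g ∈ Subgroup.closure {X, Y} := by rw [closure_XY]; trivial
    induction hg using Subgroup.closure_induction with
    | mem g hg =>
      intro e
      rcases hg with rfl | rfl
      · exact ⟨hb _ _ (black_smul e).symm, hb _ _ (black_smul e)⟩
      · exact ⟨hw _ _ (white_smul e).symm, hw _ _ (white_smul e)⟩
    | one => simp
    | mul g h _ _ hg hh => intro e; rw [hh, hg, mul_smul]
    | inv g _ hg => intro e; rw [hg (g⁻¹ • e), smul_inv_smul]
  intro e
  obtain ⟨g, rfl⟩ := QuotientGroup.mk_surjective e
  have := (key g _).1 h₀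
  rwa [baseEdge, MulAction.Quotient.smul_mk, smul_eq_mul, mul_one] at this

/-- Transport along the tree: `g e` and `u e` carry the base edge to `e`, the former is compatible
with `Y`, the latter with `X`, and they agree on the tree. -/
theorem exists_transport (t : SpanningTree (black (H := H)) white (baseEdge H)) :
    ∃ g u : Edge H → PSL(2, ℤ), g (baseEdge H) = 1 ∧
      (∀ e, Y • e ≠ e → g (Y • e) = Y * g e) ∧ (∀ e, X • e ≠ e → u (X • e) = X * u e) ∧
      (∀ e ∈ t.edges, g e = u e) ∧ (∀ e, g e • baseEdge H = e) ∧
      ∀ e, u e • baseEdge H = e := by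
  obtain ⟨ζX, hX1, hX2, hX3⟩ := exists_orbit_section (z := X) (E := Edge H)
    (by rw [orderOf_X]; norm_num) (fun e => t.parB (black e))
    (fun e => by
      obtain ⟨k, hk⟩ := MulAction.orbitRel_apply.1 (Quotient.exact' (t.b_parB (black e)).symm)
      exact ⟨k, k.2, hk⟩)
    (fun e => by rw [black_smul]) (fun e => by rw [t.b_parB])
  obtain ⟨ζY, hY1, hY2, hY3⟩ := exists_orbit_section (z := Y) (E := Edge H)
    (by rw [orderOf_Y]; norm_num) (fun e => t.parW (white e))
    (fun e => by
      obtain ⟨k, hk⟩ := MulAction.orbitRel_apply.1 (Quotient.exact' (t.w_parW (white e)).symm)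
      exact ⟨k, k.2, hk⟩)
    (fun e => by rw [white_smul]) (fun e => by rw [t.w_parW])
  -- These factors make `PB v` the value of `g` at the parent edge of `v`, where `ζX` is `1`; hence
  -- `g = u` there. White vertices are symmetric.
  obtain ⟨PB, PW, h₀, hB, hW⟩ :=
    t.exists_branch_prod (fun v => ζY (t.parB v)) (fun v => ζX (t.parW v))
  have hX3' : ∀ v, ζX (t.parB v) = 1 := fun v => by
    have := hX3 (t.parB v); rwa [t.b_parB] at this
  have hY3' : ∀ v, ζY (t.parW v) = 1 := fun v => by
    have := hY3 (t.parW v); rwa [t.w_parW] at this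
  set g : Edge H → PSL(2, ℤ) := fun e => ζY e * PW (white e) with hg
  set u : Edge H → PSL(2, ℤ) := fun e => ζX e * PB (black e) with hu
  have hg₀ : g (baseEdge H) = 1 := by
    have := hY3' (white (baseEdge H))
    rw [t.parW_root] at this
    simp only [hg, h₀, this, mul_one]
  have hgY : ∀ e, Y • e ≠ e → g (Y • e) = Y * g e := fun e he => by
    simp only [hg, white_smul, hY2 e he, mul_assoc]
  have huX : ∀ e, X • e ≠ e → u (X • e) = X * u e := fun e he => by
    simp only [hu, black_smul, hX2 e he, mul_assoc]
  have hgu : ∀ e ∈ t.edges, g e = u e := by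
    rintro _ (⟨v, rfl⟩ | ⟨v, hv, rfl⟩)
    · simp only [hg, hu, hX3', one_mul, t.b_parB, hB]
    · simp only [hg, hu, hY3', one_mul, t.w_parW, hW v hv]
  have key := t.induction (P := fun e => g e • baseEdge H = e) (Q := fun e => u e • baseEdge H = e)
    (by rw [hg₀, one_smul])
    (white_induction fun e he => by
      by_cases h : Y • e = e
      · rwa [h]
      · rw [hgY e h, mul_smul, he])
    (black_induction fun e he => by
      by_cases h : X • e = e
      · rwa [h]
      · rw [huX e h, mul_smul, he])
    (fun e he => by rw [hgu e he])
  exact ⟨g, u, hg₀, hgY, huX, hgu, fun e => (key e).1, fun e => (key e).2⟩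

open CyclicFreeProduct in
/-- A subgroup of the modular group is a free product of cyclic groups indexed by the edges of the
skeleton outside a spanning tree and by its monovalent vertices. -/
theorem nonempty_mulEquiv (t : SpanningTree (black (H := H)) white (baseEdge H)) {I J K : Type}
    (iI : I ≃ {e : Edge H // e ∉ t.edges}) (iJ : J ≃ {e : Edge H // Y • e = e})
    (iK : K ≃ {e : Edge H // X • e = e}) : Nonempty (H ≃* CyclicFreeProduct I J K) := by
  classical
  obtain ⟨g, u, hg₀, hgY, huX, hgu, hg, hu⟩ := exists_transport t
  -- `k` measures the passage from `g` to `u` at an edge, while `r` and `s` place the torsion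
  -- generators at the fixed points of `Y` and `X`.
  let k : Edge H → CyclicFreeProduct I J K := fun e =>
    if h : e ∈ t.edges then 1 else genZ (iI.symm ⟨e, h⟩)
  let r : Edge H → CyclicFreeProduct I J K := fun e =>
    if h : Y • e = e then genTwo (iJ.symm ⟨e, h⟩) else 1
  let s : Edge H → CyclicFreeProduct I J K := fun e =>
    if h : X • e = e then genThree (iK.symm ⟨e, h⟩) else 1
  have hr : ∀ e, r (Y • e) * r e = 1 := fun e => by
    by_cases h : Y • e = e
    · rw [h]; simp only [r, h, dif_pos, ← pow_two, genTwo_sq]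
    · have h' : Y • Y • e ≠ Y • e := fun h' => h (smul_left_cancel _ h')
      simp only [r, h, h', dif_neg, not_false_eq_true, mul_one]
  have hs : ∀ e, s (X ^ 2 • e) * s (X • e) * s e = 1 := fun e => by
    rw [pow_two, mul_smul]
    by_cases h : X • e = e
    · rw [h, h]; simp only [s, h, dif_pos, ← pow_two, ← pow_succ]; exact genThree_pow _
    · have h' : X • X • e ≠ X • e := fun h' => h (smul_left_cancel _ h')
      have h'' : X • X • X • e ≠ X • X • e := fun h'' => h' (smul_left_cancel _ h'')
      simp only [s, h, h', h'', dif_neg, not_false_eq_true, mul_one]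
  -- Around an `X`-orbit the factors `k` telescope, leaving a conjugate of the product of the `s`,
  -- which is `1`.
  obtain ⟨σ, hσ, hσX, hσY⟩ := exists_cocycle (E := Edge H)
    (a := fun e => k (X • e) * s e * (k e)⁻¹) (c := r) (fun e => by
      have h3 : X • X ^ 2 • e = e := by rw [smul_smul, ← pow_succ', X_pow_three, one_smul]
      have h2 : X • X • e = X ^ 2 • e := by rw [smul_smul, ← pow_two]
      have := hs e
      rw [h3, h2]
      calc _ = k e * (s (X ^ 2 • e) * s (X • e) * s e) * (k e)⁻¹ := by group
        _ = 1 := by rw [this]; group) hr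
  have hσ1 : ∀ e, σ 1 e = 1 := fun e => by simpa using hσ 1 1 e
  have hσdiv : ∀ p q : PSL(2, ℤ), p • baseEdge H = q • baseEdge H →
      σ (p⁻¹ * q) (baseEdge H) = (σ p (baseEdge H))⁻¹ * σ q (baseEdge H) := fun p q h => by
    have := hσ p (p⁻¹ * q) (baseEdge H)
    rw [mul_inv_cancel_left, mul_smul, ← h, inv_smul_smul] at this
    rw [this, inv_mul_cancel_left]
  have hmem : ∀ p q : PSL(2, ℤ), p • baseEdge H = q • baseEdge H → p⁻¹ * q ∈ H := fun p q h => by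
    rw [← smul_baseEdge_iff, mul_smul, ← h, inv_smul_smul]
  have hgu' : ∀ e, g e • baseEdge H = u e • baseEdge H := fun e => by rw [hg, hu]
  have hgY' : ∀ e, Y • e = e → g e • baseEdge H = (Y * g e) • baseEdge H := fun e h => by
    rw [mul_smul, hg, h]
  have huX' : ∀ e, X • e = e → u e • baseEdge H = (X * u e) • baseEdge H := fun e h => by
    rw [mul_smul, hu, h]
  -- Evaluated on transports, the cocycle is trivial on `g` and equals `k` on `u`; this is what
  -- makes `φ ∘ ψ` fix the generators.
  have key := t.induction (P := fun e => σ (g e) (baseEdge H) = 1)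
    (Q := fun e => σ (u e) (baseEdge H) = k e)
    (by rw [hg₀, hσ1])
    (white_induction fun e he => by
      by_cases h : Y • e = e
      · rwa [h]
      · rw [hgY e h, hσ, hg, he, hσY]; simp [r, h])
    (black_induction fun e he => by
      by_cases h : X • e = e
      · rwa [h]
      · rw [huX e h, hσ, hu, he, hσX]; simp [s, h])
    (fun e he => by rw [hgu e he]; simp [k, he])
  let φ : H →* CyclicFreeProduct I J K :=
    { toFun := fun h => σ h (baseEdge H)
      map_one' := hσ1 _
      map_mul' := fun h h' => by
        rw [Subgroup.coe_mul, hσ, smul_baseEdge_iff.2 h'.2] }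
  obtain ⟨ψ, hψZ, hψTwo, hψThree⟩ := exists_lift (L := H)
    (fun i : I => ⟨_, hmem _ _ (hgu' (iI i).1)⟩)
    (fun j : J => ⟨_, hmem _ _ (hgY' (iJ j).1 (iJ j).2)⟩)
    (fun l : K => ⟨_, hmem _ _ (huX' (iK l).1 (iK l).2)⟩)
    (fun j => Subtype.ext (conj_pow_eq_one Y_sq))
    (fun l => Subtype.ext (conj_pow_eq_one X_pow_three))
  have hψk : ∀ e, (ψ (k e) : PSL(2, ℤ)) = (g e)⁻¹ * u e := fun e => by
    by_cases h : e ∈ t.edges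
    · simp only [k, h, dif_pos, map_one, Subgroup.coe_one, hgu e h, inv_mul_cancel]
    · simp only [k, h, dif_neg, not_false_eq_true, hψZ, Equiv.apply_symm_apply]
  -- Both sides are cocycles in `z`, so it suffices to compare them at `X` and `Y`. At the base edge
  -- with `z ∈ H` the right side is `z`, giving `ψ ∘ φ = id`.
  have hψσ : ∀ z : PSL(2, ℤ), ∀ e, (ψ (σ z e) : PSL(2, ℤ)) = (g (z • e))⁻¹ * z * g e := by
    intro z
    have hz : z ∈ Subgroup.closure {X, Y} := by rw [closure_XY]; trivial
    induction hz using Subgroup.closure_induction with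
    | mem z hz =>
      intro e
      rcases hz with rfl | rfl
      · rw [hσX, map_mul, map_mul, map_inv, Subgroup.coe_mul, Subgroup.coe_mul, Subgroup.coe_inv,
          hψk, hψk]
        by_cases h : X • e = e
        · simp only [s, h, dif_pos, hψThree, Equiv.apply_symm_apply]; group
        · simp only [s, h, dif_neg, not_false_eq_true, map_one, Subgroup.coe_one, huX e h]; group
      · rw [hσY]
        by_cases h : Y • e = e
        · simp only [r, h, dif_pos, hψTwo, Equiv.apply_symm_apply]; group
        · simp only [r, h, dif_neg, not_false_eq_true, map_one, Subgroup.coe_one, hgY e h]; group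
    | one => intro e; simp [hσ1]
    | mul z z' _ _ hz hz' =>
      intro e
      rw [hσ, map_mul, Subgroup.coe_mul, hz, hz', mul_smul]; group
    | inv z _ hz =>
      intro e
      have h1 := hσ z z⁻¹ e
      rw [mul_inv_cancel, hσ1] at h1
      rw [eq_inv_of_mul_eq_one_right h1.symm, map_inv, Subgroup.coe_inv, hz, smul_inv_smul]; group
  refine ⟨MonoidHom.toMulEquiv φ ψ (MonoidHom.ext fun h => Subtype.ext ?_)
    (hom_ext (fun i => ?_) (fun j => ?_) fun l => ?_)⟩
  · change (ψ (σ h (baseEdge H)) : PSL(2, ℤ)) = h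
    rw [hψσ, smul_baseEdge_iff.2 h.2, hg₀, inv_one, one_mul, mul_one]
  · change σ (ψ (genZ i)) (baseEdge H) = genZ i
    rw [hψZ, hσdiv _ _ (hgu' _), (key _).1, (key _).2]
    simp [k, (iI i).2]
  · change σ (ψ (genTwo j)) (baseEdge H) = genTwo j
    rw [hψTwo, hσdiv _ _ (hgY' _ (iJ j).2), hσ, hg, (key _).1, hσY]
    simp [r, (iJ j).2]
  · change σ (ψ (genThree l)) (baseEdge H) = genThree l
    rw [hψThree, hσdiv _ _ (huX' _ (iK l).2), hσ, hu, (key _).2, hσX]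
    simp [s, (iK l).2]

end ModularGroupSkeleton

theorem corollary3p6 :
    (∀ H : Subgroup PSL(2, ℤ), H.FiniteIndex →
      ∃ n₀ n₂ n₃ : ℕ,
        (n₀ : ℤ) = 1 - ModularGroupSkeleton.eulerChar H ∧
        n₂ = ModularGroupSkeleton.monoWhite H ∧
        n₃ = ModularGroupSkeleton.monoBlack H ∧
        Nonempty (H ≃* CyclicFreeProduct (Fin n₀) (Fin n₂) (Fin n₃)) ∧
        (H.index : ℤ) = 6 * (n₀ : ℤ) + 3 * (n₂ : ℤ) + 4 * (n₃ : ℤ) - 6) ∧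
    (∀ H : Subgroup PSL(2, ℤ),
      ∃ I J K : Type, Nonempty (H ≃* CyclicFreeProduct I J K)) := by
  open ModularGroupSkeleton in
  refine ⟨fun H hH => ?_, fun H => ?_⟩
  · obtain ⟨t⟩ := nonempty_spanningTree H
    have : Finite (Edge H) := Subgroup.finite_quotient_of_finiteIndex
    have h₁ := t.card_edges
    have h₂ : Nat.card t.edges + Nat.card {e : Edge H // e ∉ t.edges} = Nat.card (Edge H) := by
      classical
      rw [← Nat.card_sum]
      exact Nat.card_congr (Equiv.sumCompl fun e => e ∈ t.edges)
    have hB : _ * Nat.card (BlackVertex H) = _ := prime_mul_card_orbits (E := Edge H) (z := X) (by rw [orderOf_X]; norm_num)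
    have hW : _ * Nat.card (WhiteVertex H) = _ := prime_mul_card_orbits (E := Edge H) (z := Y) (by rw [orderOf_Y]; norm_num)
    rw [orderOf_X] at hB
    rw [orderOf_Y] at hW
    have hI : H.index = Nat.card (Edge H) := rfl
    -- The edges outside the tree number `|E| - (|B| + |W| - 1)`, which also shows that `1 - χ` is
    -- nonnegative.
    have hn₀ : (Nat.card {e : Edge H // e ∉ t.edges} : ℤ) = 1 - eulerChar H := by
      rw [eulerChar]; omega
    refine ⟨_, _, _, hn₀, rfl, rfl, nonempty_mulEquiv t (Finite.equivFin _).symm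
      (Finite.equivFin _).symm (Finite.equivFin _).symm, ?_⟩
    have hE : eulerChar H = (Nat.card (BlackVertex H) : ℤ) + Nat.card (WhiteVertex H) -
      Nat.card (Edge H) := rfl
    -- From `3|B| = |E| + 2n₃` and `2|W| = |E| + n₂` one gets `6χ = 3n₂ + 4n₃ - |E|`.
    rw [hn₀, hE, hI, monoWhite, monoBlack]
    omega
  · obtain ⟨t⟩ := nonempty_spanningTree H
    exact ⟨_, _, _, nonempty_mulEquiv t (.refl _) (.refl _) (.refl _)⟩
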